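/- **Definitions.** Clauses are finite sets of literals, CNF formulas are finite sets of clauses. Two clauses $C=A\lor p$ and $D=B\lor\overline p$, where $A=C\setminus\{p\}$ and $B=D\setminus\{\overline p\}$, resolve on the literal $p$ to $A\lor B$; the inference is a *merge* if $A$ and $B$ have a literal in common. A *resolution refutation* of $F$ is a sequence of clauses ending in the empty clause in which each clause is in $F$ or is a resolvent of two earlier clauses; its length is the number of clauses in the sequence. An *input derivation* from a set $S$ of clauses starts with a clause of $S$ and in each inference resolves the last clause obtained with a clause of $S$. An *RMA (Resolution with Merge Ancestors) refutation* of $F$ is a finite sequence of input derivations such that each may use as axioms the clauses of $F$ and the last clauses of the preceding derivations, each derivation but the last one contains at least one merge, and the last one ends in the empty clause; its length is the total number of inferences. For positive integers $\ell,m,n$, the formula $F_{\ell,m,n}$ has variables $x_i$ ($1\le i\le m\ell-1$) and $w_{j,k}$ ($1\le j\le\ell$, $1\le k\le n$). Put $x_0=1$, $x_{m\ell}=0$ (constants, which are simplified away), and let $\hat\imath\in\{1,\dots,\ell\}$ be the residue of $i$ modulo $\ell$. The clauses are $$w_{j,k}\lor\overline{w_{j,k+1}},\qquad \overline{w_{j,k}}\lor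 w_{j,k+1}\qquad(1\le j\le\ell,\ 1\le k\le n-1),$$ $$w_{\hat\imath,1}\lor w_{\hat\imath,n}\lor\overline{x_{i-1}}\lor x_i,\qquad \overline{w_{\hat\imath,1}}\lor\overline{w_{\hat\imath,n}}\lor\overline{x_{i-1}}\lor x_i\qquad(1\le i\le m\ell).$$ **Theorem.** For $n\ge2$ let $F_n=F_{\lceil 48\log_2 n\rceil,\,n,\,n}$. Then $F_n$ has $O(n\log n)$ variables and $O(n\log n)$ clauses and has a resolution refutation of length $O(n\log n)$, but every RMA refutation of $F_n$ has length $\Omega(n^2\log n)$. -/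

import Mathlib

namespace MergeRes

/-! ### Clauses, CNF formulas and the resolution rule -/

/-- A literal: `(x, true)` is the variable `x`, `(x, false)` is its negation. -/
abbrev Literal (V : Type) := V × Bool

/-- The opposite literal. -/
def Literal.neg {V : Type} (p : Literal V) : Literal V := (p.1, !p.2)

/-- A clause is a finite set of literals, read as their disjunction; `∅` is the empty clause. -/
abbrev Clause (V : Type) := Finset (Literal V)

/-- A CNF formula is a finite set of clauses, read as their conjunction. -/
abbrev CNF (V : Type) := Finset (Clause V)

section
variable {V : Type} [DecidableEq V]

/-- The set of variables that occur in a CNF formula. -/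
def CNF.vars (F : CNF V) : Finset V := F.biUnion fun C => C.image Prod.fst

/-- `C` and `D` can be resolved on the literal `p`: `C = A ∨ p` and `D = B ∨ ¬p`. -/
def Resolvable (p : Literal V) (C D : Clause V) : Prop := p ∈ C ∧ p.neg ∈ D

/-- The resolvent `A ∨ B` of `C = A ∨ p` and `D = B ∨ ¬p`. -/
def resolvent (p : Literal V) (C D : Clause V) : Clause V := C.erase p ∪ D.erase p.neg

/-- The inference is a merge: `A` and `B` have a literal in common,
where `C = A ∨ p` and `D = B ∨ ¬p`. -/
def IsMerge (p : Literal V) (C D : Clause V) : Prop := (C.erase p ∩ D.erase p.neg).Nonempty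

/-! ### Resolution -/

/-- A resolution derivation from `F`: a sequence of clauses, each of which is an axiom in `F`
or the resolvent of two earlier clauses. Its length is the length of the sequence
(axioms are counted). -/
def IsResolutionDerivation (F : CNF V) (η : List (Clause V)) : Prop :=
  ∀ i : Fin η.length, η.get i ∈ F ∨
    ∃ j k : Fin η.length, j < i ∧ k < i ∧ ∃ p : Literal V,
      Resolvable p (η.get j) (η.get k) ∧ η.get i = resolvent p (η.get j) (η.get k)

/-- A resolution refutation of `F`: a derivation from `F` whose last clause is the empty clause. -/
def IsResolutionRefutation (F : CNF V) (η : List (Clause V)) : Prop :=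
  IsResolutionDerivation F η ∧ η.getLast? = some ∅

/-! ### Resolution with merge ancestors -/

/-- An input resolution derivation of a clause from a set `S` of clauses: it starts with a clause
of `S` and resolves, in every inference, the last clause obtained with a clause of `S`
(so that its graph is a maximally unbalanced tree with leaves in `S`). -/
inductive InputDerivation (S : Set (Clause V)) : Clause V → Type
  | start (C : Clause V) (hC : C ∈ S) : InputDerivation S C
  | step {D : Clause V} (d : InputDerivation S D) (C : Clause V) (hC : C ∈ S)
      (p : Literal V) (hp : Resolvable p D C) : InputDerivation S (resolvent p D C)

/-- The number of inferences of an input derivation. -/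
def InputDerivation.length {S : Set (Clause V)} :
    {C : Clause V} → InputDerivation S C → ℕ
  | _, .start _ _ => 0
  | _, .step d _ _ _ _ => d.length + 1

/-- Some inference of the input derivation is a merge. -/
def InputDerivation.ContainsMerge {S : Set (Clause V)} :
    {C : Clause V} → InputDerivation S C → Prop
  | _, .start _ _ => False
  | _, .step (D := D) d C _ p _ => d.ContainsMerge ∨ IsMerge p D C

/-- `MergeLemmas F S`: a finite sequence of input derivations, each of which contains a merge and
may use as axioms the clauses of `F` and the last clauses (the lemmas) of the derivations before
it. The set `S` consists of the clauses of `F` and all lemmas of the sequence. -/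
inductive MergeLemmas (F : Set (Clause V)) : Set (Clause V) → Type
  | nil : MergeLemmas F F
  | snoc {S : Set (Clause V)} (σ : MergeLemmas F S) {C : Clause V} (d : InputDerivation S C)
      (hd : d.ContainsMerge) : MergeLemmas F (insert C S)

/-- The total number of inferences in the sequence. -/
def MergeLemmas.length {F : Set (Clause V)} :
    {S : Set (Clause V)} → MergeLemmas F S → ℕ
  | _, .nil => 0
  | _, .snoc σ d _ => σ.length + d.length

/-- An RMA (resolution with merge ancestors) derivation of `C` from `F`: an input-structured
sequence of derivations, all of which but the last contain a merge, the last one deriving `C`. -/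
structure RMADerivation (F : CNF V) (C : Clause V) where
  /-- the axioms and lemmas available to the last derivation -/
  clauses : Set (Clause V)
  /-- all derivations but the last -/
  lemmas : MergeLemmas (F : Set (Clause V)) clauses
  /-- the last derivation -/
  last : InputDerivation clauses C

/-- The length of an RMA derivation: the total number of its inferences. -/
def RMADerivation.length {F : CNF V} {C : Clause V} (π : RMADerivation F C) : ℕ :=
  π.lemmas.length + π.last.length

/-- An RMA refutation is an RMA derivation of the empty clause. -/
abbrev RMARefutation (F : CNF V) := RMADerivation F ∅

end

/-! ### The formula -/

/-- The variables `x_i` and `w_{j,k}`. -/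
inductive FVar : Type
  | x (i : ℕ) : FVar
  | w (j k : ℕ) : FVar
  deriving DecidableEq

/-- The residue of `i` modulo `ℓ`, represented in `{1, …, ℓ}` (for `i, ℓ ≥ 1`). -/
def blockIndex (ℓ i : ℕ) : ℕ := (i - 1) % ℓ + 1

/-- The clause `B_{j,k,b}`: it is `w_{j,k} ∨ ¬w_{j,k+1}` for `b = 1` and
`¬w_{j,k} ∨ w_{j,k+1}` for `b = 0`. -/
def clauseB (j k : ℕ) (b : Bool) : Clause FVar := {(.w j k, b), (.w j (k + 1), !b)}

/-- The literal `x_i` as a clause, where `x_N` is the constant `0`. -/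
def posX (N i : ℕ) : Clause FVar := if i = N then ∅ else {(.x i, true)}

/-- The literal `¬x_i` as a clause, where `x_0` is the constant `1`. -/
def negX (i : ℕ) : Clause FVar := if i = 0 then ∅ else {(.x i, false)}

/-- The clause `A_{i,b}`, for `i ∈ {1, …, mℓ}`: with `j` the block index of `i`, it is
`w_{j,1} ∨ w_{j,n} ∨ ¬x_{i-1} ∨ x_i` for `b = 1` and
`¬w_{j,1} ∨ ¬w_{j,n} ∨ ¬x_{i-1} ∨ x_i` for `b = 0`, where `x_0 = 1` and `x_{mℓ} = 0`. -/
def clauseA (ℓ m n i : ℕ) (b : Bool) : Clause FVar :=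
  {(.w (blockIndex ℓ i) 1, b), (.w (blockIndex ℓ i) n, b)} ∪ negX (i - 1) ∪ posX (m * ℓ) i

/-- The formula `F_{ℓ,m,n}`, for positive `ℓ, m, n`. -/
def formula (ℓ m n : ℕ) : CNF FVar :=
  ((Finset.Icc 1 ℓ ×ˢ Finset.Ico 1 n ×ˢ Finset.univ).image
      fun t : ℕ × ℕ × Bool => clauseB t.1 t.2.1 t.2.2) ∪
  ((Finset.Icc 1 (m * ℓ) ×ˢ Finset.univ).image
      fun t : ℕ × Bool => clauseA ℓ m n t.1 t.2)

/-- The family `F_n = F_{48 log n, n, n}`, logarithm to base 2, rounded up. -/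
noncomputable def separatingFormula (n : ℕ) : CNF FVar :=
  formula ⌈48 * Real.logb 2 (n : ℝ)⌉₊ n n

end MergeRes

open MergeRes

open MergeRes

/-! Call the variables `w_{j,1}, …, w_{j,n}` chain `j`, and the cuts `aℓ + 1, …, (a+1)ℓ` block `a`.
Resolution proves the ends of chain `j` equivalent once, in `O(n)` lines, and reuses this for all
`m` indices `i` of that residue. Clauses derived from the chain clauses `B_{j,k,b}` alone are
implications obtained without merges, so RMA cannot keep them as lemmas and must pay for the chains
repeatedly.

To count this, set the `x_i` to the cut at `aℓ + j`, flip chain `j` after position `k`, and make all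
other chains constant: the only initial clause falsified is `B_{j,k,true}`. Every use of a chain
clause is charged to the first resolvent that also depends on another clause or a lemma. By
`Invariant`, a clause falsified in this way has been paid for by a charge at `(j, k)`, unless block
`a` is already good. The empty clause is always falsified, so all blocks become good: each has `c`
cuts charged at all `n - 1` positions. A charge counts only for blocks that its clause meets but
does not cover, and there are at most two (`card_charged_le`). Hence the length is at least `m c (n
- 1) / 2`.

A block can become covered by a resolvent on `x_u` although neither premise covers it; then one
premise is falsified by at least half of its cuts. If that premise mentions few chains, the other
chains of this half can be flipped freely, so all of them are charged (`good_of_interval`). Few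
chains are ensured by a random restriction: in each pair of neighbouring chains one stays free and
the other becomes constant. A clause mentioning `t` chains survives with probability at most
`(3/4)^t`, so `t`, and with it `ℓ`, of order `log n` suffices (`exists_narrow`). -/

namespace MergeRes

/-! ### Falsified clauses -/

/-- The indices `j` of the variables `w_{j,k}` in a clause. -/
def blocksOf (C : Clause FVar) : Finset ℕ :=
  C.biUnion fun l => match l.1 with
    | .w j _ => {j}
    | .x _ => ∅

theorem mem_blocksOf {C : Clause FVar} {j : ℕ} :
    j ∈ blocksOf C ↔ ∃ k s, (FVar.w j k, s) ∈ C := by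
  simp only [blocksOf, Finset.mem_biUnion, Prod.exists]
  constructor
  · rintro ⟨v, s, h, hj⟩
    cases v with
    | x i => simp at hj
    | w j' k => simp at hj; subst hj; exact ⟨k, s, h⟩
  · rintro ⟨k, s, h⟩
    exact ⟨_, s, h, by simp⟩

/-- Outside of the free blocks `B`, all literals `w_{j,k}` and `¬w_{j,k}` of the clause have the
sign `ρ j`. -/
def Alive (B : Set ℕ) (ρ : ℕ → Bool) (C : Clause FVar) : Prop :=
  ∀ j k s, (FVar.w j k, s) ∈ C → j ∈ B ∨ s = ρ j

/-- The literals `x_v` and `¬x_v` of the clause are false if `x_v = 1` exactly for `v < i`. -/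
def CutFalse (i : ℕ) (C : Clause FVar) : Prop :=
  (∀ v, (FVar.x v, true) ∈ C → i ≤ v) ∧ ∀ v, (FVar.x v, false) ∈ C → v < i

/-- The clause is falsified by all cuts in the block `(aℓ, (a+1)ℓ]`. -/
def Far (ℓ a : ℕ) (C : Clause FVar) : Prop :=
  ∀ j, 1 ≤ j → j ≤ ℓ → CutFalse (a * ℓ + j) C

/-- The literals `w_{j,k'}` and `¬w_{j,k'}` of the clause are false
if `w_{j,k'} = 0` exactly for `k' ≤ k`. -/
def FlipFalse (j k : ℕ) (C : Clause FVar) : Prop :=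
  ∀ k' s, (FVar.w j k', s) ∈ C → (s = true ↔ k' ≤ k)

/-- A set of charges `(j, k, E)`, each recording a use of a clause `B_{j,k,b}` attributed to the
clause `E`. -/
abbrev Charges := Finset (ℕ × ℕ × Clause FVar)

/-- Some charge at `j`, `k` is attributed to a clause that is falsified by the cut `aℓ + j`,
but not by all cuts of its block. -/
def Charged (ℓ : ℕ) (Q : Charges) (a j k : ℕ) : Prop :=
  ∃ E, (j, k, E) ∈ Q ∧ CutFalse (a * ℓ + j) E ∧ ¬ Far ℓ a E

/-- At least `c` cuts of the block are charged at every `k`. -/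
def Good (ℓ n c : ℕ) (Q : Charges) (a : ℕ) : Prop :=
  ∃ s : Finset ℕ, s ⊆ Finset.Icc 1 ℓ ∧ c ≤ s.card ∧
    ∀ j ∈ s, ∀ k, 1 ≤ k → k < n → Charged ℓ Q a j k

/-- Every interval in `{1, …, ℓ}` of length at least `ℓ / 2` has at least `N` elements in `B`. -/
def Spread (ℓ N : ℕ) (B : Set ℕ) : Prop :=
  ∀ u v, 1 ≤ u → v ≤ ℓ → ℓ + 2 * u ≤ 2 * (v + 1) →
    ∃ s ⊆ Finset.Icc u v, (∀ j ∈ s, j ∈ B) ∧ N ≤ s.card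

/-- The invariant of the lines of an RMA derivation that are not derived from clauses
`B_{j,k,b}` alone. -/
structure Invariant (ℓ m n c t : ℕ) (B : Set ℕ) (ρ : ℕ → Bool) (Q : Charges)
    (C : Clause FVar) : Prop where
  narrow : Alive B ρ C → (blocksOf C).card < t
  far : ∀ a < m, Alive B ρ C → Far ℓ a C → Good ℓ n c Q a
  flip : ∀ a < m, ∀ j ∈ B, 1 ≤ j → j ≤ ℓ → ∀ k, 1 ≤ k → k < n → Alive B ρ C →
    CutFalse (a * ℓ + j) C → FlipFalse j k C → Good ℓ n c Q a ∨ Charged ℓ Q a j k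

/-- An implication `w_{j,b} → w_{j,a}` all of whose falsifying flips are in `R`. -/
def IsImplication (R : ℕ → ℕ → Prop) (C : Clause FVar) : Prop :=
  ∃ j a b, C = {(.w j a, true), (.w j b, false)} ∧ ∀ k, a ≤ k → k < b → R j k

/-! ### Resolvents and falsified premises -/

theorem resolvent_comm (p : Literal FVar) (C D : Clause FVar) :
    resolvent p C D = resolvent p.neg D C := by
  simp [resolvent, Literal.neg, Finset.union_comm]

section resolution
variable {v : FVar} {C D : Clause FVar}

theorem mem_resolvent_left {l : Literal FVar} (h : l ∈ C) (hl : l ≠ (v, true)) :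
    l ∈ resolvent (v, true) C D := by
  simp [resolvent, h, hl]

theorem mem_resolvent_right {l : Literal FVar} (h : l ∈ D) (hl : l ≠ (v, false)) :
    l ∈ resolvent (v, true) C D := by
  simp [resolvent, Literal.neg, h, hl]

/-- If every literal of `C` other than `l` is a literal of `E`, then `C` inherits these. -/
theorem CutFalse.of_subset {i : ℕ} {E : Clause FVar} {l : Literal FVar}
    (h : ∀ q ∈ C, q ≠ l → q ∈ E) (hE : CutFalse i E)
    (hl : (∀ v, l = (.x v, true) → i ≤ v) ∧ ∀ v, l = (.x v, false) → v < i) :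
    CutFalse i C := by
  refine ⟨fun v hv => ?_, fun v hv => ?_⟩
  · by_cases e : l = (.x v, true)
    · exact hl.1 v e
    · exact hE.1 v (h _ hv (Ne.symm e))
  · by_cases e : l = (.x v, false)
    · exact hl.2 v e
    · exact hE.2 v (h _ hv (Ne.symm e))

theorem Alive.of_subset {B : Set ℕ} {ρ : ℕ → Bool} {E : Clause FVar} {l : Literal FVar}
    (h : ∀ q ∈ C, q ≠ l → q ∈ E) (hE : Alive B ρ E)
    (hl : ∀ j k s, l = (.w j k, s) → j ∈ B ∨ s = ρ j) : Alive B ρ C := by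
  intro j k s hv
  by_cases e : l = (.w j k, s)
  · exact hl j k s e
  · exact hE j k s (h _ hv (Ne.symm e))

theorem FlipFalse.of_subset {j k : ℕ} {E : Clause FVar} {l : Literal FVar}
    (h : ∀ q ∈ C, q ≠ l → q ∈ E) (hE : FlipFalse j k E)
    (hl : ∀ k' s, l = (.w j k', s) → (s = true ↔ k' ≤ k)) : FlipFalse j k C := by
  intro k' s hv
  by_cases e : l = (.w j k', s)
  · exact hl k' s e
  · exact hE k' s (h _ hv (Ne.symm e))

end resolution

theorem IsImplication.not_mem_x {R : ℕ → ℕ → Prop} {C : Clause FVar} (h : IsImplication R C)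
    (v : ℕ) (s : Bool) : (FVar.x v, s) ∉ C := by
  obtain ⟨j, a, b, rfl, -⟩ := h
  simp

theorem IsImplication.exists_mem {R : ℕ → ℕ → Prop} {C : Clause FVar} (h : IsImplication R C)
    {j k : ℕ} {s : Bool} (hC : (FVar.w j k, s) ∈ C) : ∃ k', (FVar.w j k', !s) ∈ C := by
  obtain ⟨j', a, b, rfl, -⟩ := h
  simp only [Finset.mem_insert, Finset.mem_singleton, Prod.mk.injEq, FVar.w.injEq] at hC
  rcases hC with ⟨⟨rfl, rfl⟩, rfl⟩ | ⟨⟨rfl, rfl⟩, rfl⟩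
  · exact ⟨b, by simp⟩
  · exact ⟨a, by simp⟩

theorem IsImplication.of_flipFalse {R : ℕ → ℕ → Prop} {C : Clause FVar} (h : IsImplication R C)
    {j c k : ℕ} {s : Bool} (hC : (FVar.w j c, s) ∈ C) (hk : FlipFalse j k C) : R j k := by
  obtain ⟨j', a, b, rfl, hR⟩ := h
  obtain rfl : j = j' := by
    simp only [Finset.mem_insert, Finset.mem_singleton, Prod.mk.injEq, FVar.w.injEq] at hC
    rcases hC with h | h <;> exact h.1.1
  refine hR k ((hk a true (by simp)).1 rfl) ?_
  have := hk b false (by simp)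
  simpa using this

/-! ### Preservation of the invariant under resolution -/

section step
variable {ℓ m n c t : ℕ} {B : Set ℕ} {ρ : ℕ → Bool} {Q : Charges} {v : FVar} {C D : Clause FVar}

/-- Block `a` is good if a long interval of its cuts falsifies an alive clause with the
invariant. -/
theorem good_of_interval {a u v : ℕ}
    (hB : Spread ℓ (c + t) B)
    (hC : Invariant ℓ m n c t B ρ Q C) (ha : a < m) (hal : Alive B ρ C)
    (hu : 1 ≤ u) (hv : v ≤ ℓ) (huv : ℓ + 2 * u ≤ 2 * (v + 1))
    (hcut : ∀ j, u ≤ j → j ≤ v → CutFalse (a * ℓ + j) C) : Good ℓ n c Q a := by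
  by_contra hg
  -- Fewer than `t` of the `c + t` free chains occur in `C`; for the others every flip falsifies `C`
  -- vacuously.
  obtain ⟨s, hs, hsB, hcard⟩ := hB u v hu hv huv
  refine hg ⟨s \ blocksOf C, ?_, ?_, ?_⟩
  · intro j hj
    have := Finset.mem_Icc.1 (hs (Finset.mem_sdiff.1 hj).1)
    exact Finset.mem_Icc.2 ⟨by omega, by omega⟩
  · have := hC.narrow hal
    have := Finset.le_card_sdiff (blocksOf C) s
    omega
  · intro j hj k hk hkn
    obtain ⟨hj, hjC⟩ := Finset.mem_sdiff.1 hj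
    have hj' := Finset.mem_Icc.1 (hs hj)
    refine (hC.flip a ha j (hsB j hj) (by omega) (by omega) k hk hkn hal
      (hcut j hj'.1 hj'.2) ?_).resolve_left hg
    intro k' s hks
    exact absurd (mem_blocksOf.2 ⟨k', s, hks⟩) hjC

/-- An assignment falsifying the resolvent falsifies a premise; the work is to find one that is also
alive and has the invariant. This fails only if a flip falsifies an implication, whose chain clauses
are then charged to the resolvent. -/
theorem Invariant.resolvent_pos
    (hB : Spread ℓ (c + t) B)
    (hvC : (v, true) ∈ C) (hvD : (v, false) ∈ D)
    (hC : Invariant ℓ m n c t B ρ Q C ∨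
      IsImplication (fun j k => (j, k, resolvent (v, true) C D) ∈ Q) C)
    (hD : Invariant ℓ m n c t B ρ Q D ∨
      IsImplication (fun j k => (j, k, resolvent (v, true) C D) ∈ Q) D)
    (hCD : Invariant ℓ m n c t B ρ Q C ∨ Invariant ℓ m n c t B ρ Q D)
    (hn : Alive B ρ (resolvent (v, true) C D) → (blocksOf (resolvent (v, true) C D)).card < t) :
    Invariant ℓ m n c t B ρ Q (resolvent (v, true) C D) := by
  set E := resolvent (v, true) C D with hE
  have sC : ∀ q ∈ C, q ≠ (v, true) → q ∈ E := fun q h h' => mem_resolvent_left h h'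
  have sD : ∀ q ∈ D, q ≠ (v, false) → q ∈ E := fun q h h' => mem_resolvent_right h h'
  -- a premise that satisfies the invariant and is alive
  have pick : Alive B ρ E → ∀ j k, v = .w j k →
      ∃ s X, (∀ q ∈ X, q ≠ (v, s) → q ∈ E) ∧ Invariant ℓ m n c t B ρ Q X ∧ Alive B ρ X := by
    intro hal j k hv
    by_cases hj : j ∈ B
    · rcases hCD with h | h
      · refine ⟨true, C, sC, h, hal.of_subset sC ?_⟩
        subst hv; simp only [Prod.mk.injEq, FVar.w.injEq]
        rintro j' k' s ⟨⟨rfl, rfl⟩, rfl⟩; exact Or.inl hj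
      · refine ⟨false, D, sD, h, hal.of_subset sD ?_⟩
        subst hv; simp only [Prod.mk.injEq, FVar.w.injEq]
        rintro j' k' s ⟨⟨rfl, rfl⟩, rfl⟩; exact Or.inl hj
    · subst hv
      rcases hρ : ρ j with _ | _
      · refine ⟨false, D, sD, hD.resolve_right fun h => ?_, hal.of_subset sD ?_⟩
        -- An implication has both signs in its chain, and the literal left in `E` would have the
        -- wrong one for a chain that is not free.
        · obtain ⟨k', hk'⟩ := h.exists_mem hvD
          have := hal j k' _ (sD _ hk' (by simp))
          simp [hj, hρ] at this
        · simp only [Prod.mk.injEq, FVar.w.injEq]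
          rintro j' k' s ⟨⟨rfl, rfl⟩, rfl⟩; exact Or.inr hρ.symm
      · refine ⟨true, C, sC, hC.resolve_right fun h => ?_, hal.of_subset sC ?_⟩
        · obtain ⟨k', hk'⟩ := h.exists_mem hvC
          have := hal j k' _ (sC _ hk' (by simp))
          simp [hj, hρ] at this
        · simp only [Prod.mk.injEq, FVar.w.injEq]
          rintro j' k' s ⟨⟨rfl, rfl⟩, rfl⟩; exact Or.inr hρ.symm
  have hfar : ∀ a < m, Alive B ρ E → Far ℓ a E → Good ℓ n c Q a := by
    intro a ha hal hf
    cases v with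
    | w j k =>
      obtain ⟨s, X, hX, hI, hXal⟩ := pick hal j k rfl
      exact hI.far a ha hXal fun j hj hjl => (hf j hj hjl).of_subset hX (by simp)
    | x u =>
      have iC := hC.resolve_right fun h => h.not_mem_x u true hvC
      have iD := hD.resolve_right fun h => h.not_mem_x u false hvD
      have alC : Alive B ρ C := hal.of_subset sC (by simp)
      have alD : Alive B ρ D := hal.of_subset sD (by simp)
      have cutC : ∀ j, 1 ≤ j → j ≤ ℓ → a * ℓ + j ≤ u → CutFalse (a * ℓ + j) C :=
        fun j h1 h2 h3 => (hf j h1 h2).of_subset sC (by simp; omega)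
      have cutD : ∀ j, 1 ≤ j → j ≤ ℓ → u < a * ℓ + j → CutFalse (a * ℓ + j) D :=
        fun j h1 h2 h3 => (hf j h1 h2).of_subset sD (by simp; omega)
      rcases le_or_gt (a * ℓ + ℓ) u with h | h
      · exact iC.far a ha alC fun j h1 h2 => cutC j h1 h2 (by omega)
      rcases le_or_gt u (a * ℓ) with h' | h'
      · exact iD.far a ha alD fun j h1 h2 => cutD j h1 h2 (by omega)
      obtain ⟨w, rfl⟩ := Nat.exists_eq_add_of_lt h'
      -- Cuts up to `u` falsify `C`, later ones `D`; take the premise that gets at least half of the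
      -- block.
      rcases le_or_gt ℓ (2 * (w + 1)) with h2 | h2
      · exact good_of_interval (u := 1) (v := w + 1) hB iC ha alC le_rfl (by omega) (by omega)
          fun j h3 h4 => cutC j h3 (by omega) (by omega)
      · exact good_of_interval (u := w + 2) (v := ℓ) hB iD ha alD (by omega) le_rfl (by omega)
          fun j h3 h4 => cutD j (by omega) h4 (by omega)
  refine ⟨hn, hfar, ?_⟩
  intro a ha j hj hj1 hjl k hk hkn hal hcut hflip
  -- Charging to `E` is only allowed if `E` does not cover the block.
  by_cases hf : Far ℓ a E
  · exact Or.inl (hfar a ha hal hf)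
  cases v with
  | x u =>
    rcases le_or_gt (a * ℓ + j) u with h | h
    · exact (hC.resolve_right fun h => h.not_mem_x u true hvC).flip a ha j hj hj1 hjl k hk hkn
        (hal.of_subset sC (by simp)) (hcut.of_subset sC (by simp; omega))
        (hflip.of_subset sC (by simp))
    · exact (hD.resolve_right fun h => h.not_mem_x u false hvD).flip a ha j hj hj1 hjl k hk hkn
        (hal.of_subset sD (by simp)) (hcut.of_subset sD (by simp; omega))
        (hflip.of_subset sD (by simp))
  | w j' k' =>
    by_cases hjj : j' = j
    · subst hjj
      -- The flip at `k` sets `w_{j,k'}` to `0` exactly for `k' ≤ k`, which decides the premise to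
      -- follow.
      rcases le_or_gt k' k with h | h
      · have hfC : FlipFalse j' k C := hflip.of_subset sC (by
          simp only [Prod.mk.injEq, FVar.w.injEq]
          rintro _ _ ⟨⟨-, rfl⟩, rfl⟩; simp [h])
        rcases hC with hC | hC
        · exact hC.flip a ha j' hj hj1 hjl k hk hkn
            (hal.of_subset sC (by
              simp only [Prod.mk.injEq, FVar.w.injEq]
              rintro _ _ _ ⟨⟨rfl, -⟩, -⟩; exact Or.inl hj))
            (hcut.of_subset sC (by simp)) hfC
        · exact Or.inr ⟨E, hC.of_flipFalse hvC hfC, hcut, hf⟩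
      · have hfD : FlipFalse j' k D := hflip.of_subset sD (by
          simp only [Prod.mk.injEq, FVar.w.injEq]
          rintro _ _ ⟨⟨-, rfl⟩, rfl⟩; simp [h])
        rcases hD with hD | hD
        · exact hD.flip a ha j' hj hj1 hjl k hk hkn
            (hal.of_subset sD (by
              simp only [Prod.mk.injEq, FVar.w.injEq]
              rintro _ _ _ ⟨⟨rfl, -⟩, -⟩; exact Or.inl hj))
            (hcut.of_subset sD (by simp)) hfD
        · exact Or.inr ⟨E, hD.of_flipFalse hvD hfD, hcut, hf⟩
    · obtain ⟨s, X, hX, hI, hXal⟩ := pick hal j' k' rfl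
      exact hI.flip a ha j hj hj1 hjl k hk hkn hXal (hcut.of_subset hX (by simp))
        (hflip.of_subset hX (by simp [hjj]))

theorem Invariant.resolvent {p : Literal FVar}
    (hB : Spread ℓ (c + t) B)
    (hp : Resolvable p C D)
    (hC : Invariant ℓ m n c t B ρ Q C ∨
      IsImplication (fun j k => (j, k, MergeRes.resolvent p C D) ∈ Q) C)
    (hD : Invariant ℓ m n c t B ρ Q D ∨
      IsImplication (fun j k => (j, k, MergeRes.resolvent p C D) ∈ Q) D)
    (hCD : Invariant ℓ m n c t B ρ Q C ∨ Invariant ℓ m n c t B ρ Q D)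
    (hn : Alive B ρ (MergeRes.resolvent p C D) → (blocksOf (MergeRes.resolvent p C D)).card < t) :
    Invariant ℓ m n c t B ρ Q (MergeRes.resolvent p C D) := by
  obtain ⟨v, _ | _⟩ := p
  · rw [resolvent_comm] at *
    exact Invariant.resolvent_pos hB hp.2 hp.1 hD hC hCD.symm hn
  · exact Invariant.resolvent_pos hB hp.1 hp.2 hC hD hCD hn

end step

/-! ### The invariant along an RMA derivation -/

theorem IsImplication.mono {R R' : ℕ → ℕ → Prop} {C : Clause FVar} (h : ∀ j k, R j k → R' j k) :
    IsImplication R C → IsImplication R' C := by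
  rintro ⟨j, a, b, hC, hR⟩
  exact ⟨j, a, b, hC, fun k h1 h2 => h _ _ (hR k h1 h2)⟩

theorem isImplication_clauseB (j k : ℕ) (b : Bool) :
    IsImplication (fun j' k' => j' = j ∧ k' = k) (clauseB j k b) := by
  cases b
  · exact ⟨j, k + 1, k, by simp [clauseB, Finset.pair_comm], by omega⟩
  · exact ⟨j, k, k + 1, by simp [clauseB], by omega⟩

/-- Implications compose, and the flips falsifying the composite falsify one of the two. After
removing the pivot, one premise keeps a positive and the other a negative literal, so there is no
merge. -/
theorem IsImplication.resolvent {R : ℕ → ℕ → Prop} {C D : Clause FVar} {p : Literal FVar}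
    (hC : IsImplication R C) (hD : IsImplication R D) (hp : Resolvable p C D) :
    IsImplication R (MergeRes.resolvent p C D) ∧ ¬ IsMerge p C D := by
  obtain ⟨j, a, b, rfl, hR⟩ := hC
  obtain ⟨j', a', b', rfl, hR'⟩ := hD
  obtain ⟨h1, h2⟩ := hp
  simp only [Finset.mem_insert, Finset.mem_singleton] at h1
  rcases h1 with rfl | rfl
  · simp only [Literal.neg, Finset.mem_insert, Finset.mem_singleton, Prod.mk.injEq,
      FVar.w.injEq, Bool.not_true, Bool.false_eq_true, and_false, false_or, and_true] at h2
    obtain ⟨rfl, rfl⟩ := h2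
    have e1 : ({(.w j a, true), (.w j b, false)} : Clause FVar).erase (.w j a, true)
        = {(.w j b, false)} := by ext; simp
    have e2 : ({(.w j a', true), (.w j a, false)} : Clause FVar).erase (.w j a, false)
        = {(.w j a', true)} := by ext; simp; grind
    refine ⟨⟨j, a', b, ?_, fun k hk hk' => ?_⟩, ?_⟩
    · simp only [MergeRes.resolvent, Literal.neg, Bool.not_true, e1, e2]
      ext; simp; tauto
    · rcases le_or_gt a k with h | h
      · exact hR k h hk'
      · exact hR' k hk h
    · simp [IsMerge, Literal.neg, e1, e2]
  · simp only [Literal.neg, Finset.mem_insert, Finset.mem_singleton, Prod.mk.injEq,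
      FVar.w.injEq, Bool.not_false, Bool.true_eq_false, and_false, or_false, and_true] at h2
    obtain ⟨rfl, rfl⟩ := h2
    have e1 : ({(.w j a, true), (.w j b, false)} : Clause FVar).erase (.w j b, false)
        = {(.w j a, true)} := by ext; simp; grind
    have e2 : ({(.w j b, true), (.w j b', false)} : Clause FVar).erase (.w j b, true)
        = {(.w j b', false)} := by ext; simp
    refine ⟨⟨j, a, b', ?_, fun k hk hk' => ?_⟩, ?_⟩
    · simp only [MergeRes.resolvent, Literal.neg, Bool.not_false, e1, e2]
      ext; simp
    · rcases le_or_gt b k with h | h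
      · exact hR' k h hk'
      · exact hR k hk h
    · simp [IsMerge, Literal.neg, e1, e2]

/-- All alive clauses of `L` mention less than `t` blocks. -/
def Narrow (t : ℕ) (B : Set ℕ) (ρ : ℕ → Bool) (L : Finset (Clause FVar)) : Prop :=
  ∀ E ∈ L, Alive B ρ E → (blocksOf E).card < t

/-- As long as only chain clauses are used, they are collected in `R` and no merge occurs;
afterwards the invariant holds. `L` and `Q` depend on the derivation alone, so that `B` and `ρ` can
be chosen later in terms of `L`; `Q'` admits the charges of other derivations. -/
theorem InputDerivation.exists_charges (ℓ m n c t : ℕ) {S : Set (Clause FVar)} {C : Clause FVar}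
    (d : InputDerivation S C) : ∃ L : Finset (Clause FVar), L.card ≤ d.length + 1 ∧
      ((∃ R : Finset (ℕ × ℕ), R.card ≤ d.length + 1 ∧ IsImplication (fun j k => (j, k) ∈ R) C ∧
          ¬ d.ContainsMerge) ∨
        ∃ Q : Charges, Q.card ≤ d.length ∧ ∀ Q' B ρ, Q ⊆ Q' → Spread ℓ (c + t) B →
          Narrow t B ρ L →
          (∀ E ∈ S, (∃ j k b, E = clauseB j k b) ∨ Invariant ℓ m n c t B ρ Q' E) →
          Invariant ℓ m n c t B ρ Q' C) := by
  induction d with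
  | start C hC =>
    refine ⟨∅, by simp, ?_⟩
    by_cases h : ∃ j k b, C = clauseB j k b
    · obtain ⟨j, k, b, rfl⟩ := h
      refine Or.inl ⟨{(j, k)}, by simp, (isImplication_clauseB j k b).mono (by simp), ?_⟩
      simp [ContainsMerge]
    · exact Or.inr ⟨∅, by simp, fun Q' B ρ _ _ _ hS => (hS C hC).resolve_left h⟩
  | @step D d C hC p hp ih =>
    obtain ⟨L, hL, ih⟩ := ih
    refine ⟨insert (resolvent p D C) L, (Finset.card_insert_le _ _).trans (by
      simpa [InputDerivation.length] using hL), ?_⟩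
    have hLn : ∀ {B ρ}, Narrow t B ρ (insert (resolvent p D C) L) → Narrow t B ρ L ∧
        (Alive B ρ (resolvent p D C) → (blocksOf (resolvent p D C)).card < t) := fun h =>
      ⟨fun E hE => h E (Finset.mem_insert_of_mem hE), h _ (Finset.mem_insert_self _ _)⟩
    by_cases h : ∃ j k b, C = clauseB j k b
    · obtain ⟨j, k, b, rfl⟩ := h
      rcases ih with ⟨R, hR, hD, hm⟩ | ⟨Q, hQ, ih⟩
      · have := (hD.mono (R' := fun j' k' => (j', k') ∈ insert (j, k) R)
          fun _ _ h => Finset.mem_insert_of_mem h).resolvent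
          ((isImplication_clauseB j k b).mono (by simp)) hp
        refine Or.inl ⟨insert (j, k) R, (Finset.card_insert_le _ _).trans (by
          simpa [InputDerivation.length] using hR), this.1, ?_⟩
        simp [ContainsMerge, hm, this.2]
      · refine Or.inr ⟨insert (j, k, resolvent p D (clauseB j k b)) Q,
          (Finset.card_insert_le _ _).trans (by simpa [InputDerivation.length] using hQ), ?_⟩
        intro Q' B ρ hQ' hB hn hS
        have hI := ih Q' B ρ ((Finset.subset_insert _ _).trans hQ') hB (hLn hn).1 hS
        refine Invariant.resolvent hB hp (Or.inl hI) (Or.inr ?_) (Or.inl hI) (hLn hn).2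
        refine (isImplication_clauseB j k b).mono ?_
        rintro _ _ ⟨rfl, rfl⟩
        exact hQ' (Finset.mem_insert_self _ _)
    · rcases ih with ⟨R, hR, hD, hm⟩ | ⟨Q, hQ, ih⟩
      -- The chain phase ends: all of `R` is charged to this resolvent, whose inference pays for the
      -- extra `1` in the bound on `R`.
      · refine Or.inr ⟨R.image fun r => (r.1, r.2, resolvent p D C),
          Finset.card_image_le.trans (by simpa [InputDerivation.length] using hR), ?_⟩
        intro Q' B ρ hQ' hB hn hS
        have hI := (hS C hC).resolve_left h
        refine Invariant.resolvent hB hp (Or.inr (hD.mono ?_)) (Or.inl hI) (Or.inr hI) (hLn hn).2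
        intro j k hjk
        exact hQ' (Finset.mem_image.2 ⟨(j, k), hjk, rfl⟩)
      · refine Or.inr ⟨Q, hQ.trans (by simp [InputDerivation.length]), ?_⟩
        intro Q' B ρ hQ' hB hn hS
        have hI := ih Q' B ρ hQ' hB (hLn hn).1 hS
        exact Invariant.resolvent hB hp (Or.inl hI) (Or.inl ((hS C hC).resolve_left h))
          (Or.inl hI) (hLn hn).2

theorem InputDerivation.length_pos {S : Set (Clause FVar)} {C : Clause FVar}
    (d : InputDerivation S C) (h : d.ContainsMerge) : 0 < d.length := by
  cases d with
  | start => exact h.elim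
  | step => exact Nat.succ_pos _

/-! ### The invariant for initial clauses and whole refutations -/

theorem mem_negX {i : ℕ} {l : Literal FVar} : l ∈ negX i ↔ i ≠ 0 ∧ l = (.x i, false) := by
  by_cases h : i = 0 <;> simp [negX, h]

theorem mem_posX {N i : ℕ} {l : Literal FVar} : l ∈ posX N i ↔ i ≠ N ∧ l = (.x i, true) := by
  by_cases h : i = N <;> simp [posX, h]

theorem mem_clauseA {ℓ m n i : ℕ} {b : Bool} {l : Literal FVar} : l ∈ clauseA ℓ m n i b ↔
    l = (.w (blockIndex ℓ i) 1, b) ∨ l = (.w (blockIndex ℓ i) n, b) ∨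
      (i - 1 ≠ 0 ∧ l = (.x (i - 1), false)) ∨ (i ≠ m * ℓ ∧ l = (.x i, true)) := by
  simp only [clauseA, Finset.mem_union, mem_negX, mem_posX, Finset.mem_insert,
    Finset.mem_singleton, or_assoc]

theorem blockIndex_add {ℓ a j : ℕ} (hj : 1 ≤ j) (hjl : j ≤ ℓ) :
    blockIndex ℓ (a * ℓ + j) = j := by
  have : a * ℓ + j - 1 = (j - 1) + ℓ * a := by rw [mul_comm]; omega
  rw [blockIndex, this, Nat.add_mul_mod_self_left, Nat.mod_eq_of_lt (by omega)]
  omega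

/-- The literals `¬x_{i-1}` and `x_i` bound the cut from both sides; where one is a simplified
constant, the range of `i'` replaces it. -/
theorem eq_of_cutFalse_clauseA {ℓ m n i i' : ℕ} {b : Bool} (hi : 1 ≤ i)
    (hi' : 1 ≤ i') (him' : i' ≤ m * ℓ) (h : CutFalse i' (clauseA ℓ m n i b)) : i' = i := by
  have h1 := h.1 i
  have h2 := h.2 (i - 1)
  simp only [mem_clauseA] at h1 h2
  have h3 : i ≤ i' := by
    by_cases e : i - 1 = 0
    · omega
    · have := h2 (Or.inr (Or.inr (Or.inl ⟨e, trivial⟩)))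
      omega
  have h4 : i' ≤ i := by
    by_cases e : i = m * ℓ
    · omega
    · exact h1 (Or.inr (Or.inr (Or.inr ⟨e, trivial⟩)))
  omega

/-- Only the cut `i` falsifies the `x`-literals, so no block of two or more cuts is covered. A flip
gives `w_{j,1}` and `w_{j,n}` different values and satisfies the clause. -/
theorem invariant_clauseA {ℓ m n c t i : ℕ} {B : Set ℕ} {ρ : ℕ → Bool} {Q : Charges} {b : Bool}
    (hℓ : 2 ≤ ℓ) (ht : 2 ≤ t) (hi : 1 ≤ i) :
    Invariant ℓ m n c t B ρ Q (clauseA ℓ m n i b) := by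
  have hblock : ∀ a < m, ∀ j ≤ ℓ, a * ℓ + j ≤ m * ℓ := fun a ha j hj => by
    have := Nat.mul_le_mul_right ℓ (Nat.succ_le_of_lt ha)
    rw [Nat.succ_mul] at this
    omega
  refine ⟨fun _ => ?_, fun a ha _ hf => ?_, ?_⟩
  · refine lt_of_le_of_lt (Finset.card_le_card (t := {blockIndex ℓ i}) ?_) (by simpa using Nat.lt_of_succ_le ht)
    intro j hj
    obtain ⟨k, s, h⟩ := mem_blocksOf.1 hj
    simp only [mem_clauseA, Prod.mk.injEq, FVar.w.injEq, reduceCtorEq, false_and, and_false,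
      or_false] at h
    simp only [Finset.mem_singleton]
    tauto
  · have h1 := eq_of_cutFalse_clauseA hi (by omega) (hblock a ha 1 (by omega))
      (hf 1 le_rfl (by omega))
    have h2 := eq_of_cutFalse_clauseA hi (by omega) (hblock a ha 2 (by omega))
      (hf 2 (by omega) hℓ)
    omega
  · intro a ha j _ hj hjl k hk hkn _ hcut hflip
    have h1 := eq_of_cutFalse_clauseA hi (by omega) (hblock a ha j hjl) hcut
    have h2 : blockIndex ℓ i = j := by rw [← h1, blockIndex_add hj hjl]
    have h3 := hflip 1 b (by simp [mem_clauseA, h2])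
    have h4 := hflip n b (by simp [mem_clauseA, h2])
    have := h4.1 (h3.2 hk)
    omega

/-- A derivation with a merge has left the chain phase, so its lemma has the invariant. It is also
nonempty, whence `d.length + 1 ≤ 2 * d.length`. -/
theorem MergeLemmas.exists_charges {ℓ m n t : ℕ} (c : ℕ) (hℓ : 2 ≤ ℓ) (ht : 2 ≤ t)
    {S : Set (Clause FVar)}
    (σ : MergeLemmas (formula ℓ m n : Set (Clause FVar)) S) :
    ∃ (L : Finset (Clause FVar)) (Q : Charges), L.card ≤ 2 * σ.length ∧ Q.card ≤ σ.length ∧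
      ∀ Q' B ρ, Q ⊆ Q' → Spread ℓ (c + t) B → Narrow t B ρ L →
        ∀ E ∈ S, (∃ j k b, E = clauseB j k b) ∨ Invariant ℓ m n c t B ρ Q' E := by
  induction σ with
  | nil =>
    refine ⟨∅, ∅, by simp, by simp, ?_⟩
    intro Q' B ρ _ _ _ E hE
    simp only [formula, Finset.coe_union, Set.mem_union, Finset.mem_coe, Finset.mem_image,
      Finset.mem_product, Finset.mem_Icc, Finset.mem_univ, and_true] at hE
    rcases hE with ⟨x, -, rfl⟩ | ⟨x, hx, rfl⟩
    · exact Or.inl ⟨_, _, _, rfl⟩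
    · exact Or.inr (invariant_clauseA hℓ ht hx.1)
  | @snoc S σ C d hd ih =>
    obtain ⟨L, Q, hL, hQ, ih⟩ := ih
    obtain ⟨L₁, hL₁, ⟨R, -, -, h⟩ | ⟨Q₁, hQ₁, h⟩⟩ := d.exists_charges ℓ m n c t
    · exact absurd hd h
    have := d.length_pos hd
    refine ⟨L ∪ L₁, Q ∪ Q₁, (Finset.card_union_le _ _).trans ?_,
      (Finset.card_union_le _ _).trans ?_, ?_⟩
    · simp only [MergeLemmas.length]; omega
    · simp only [MergeLemmas.length]; omega
    intro Q' B ρ hQ' hB hn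
    have hS := ih Q' B ρ (Finset.subset_union_left.trans hQ') hB
      fun E hE => hn E (Finset.mem_union_left _ hE)
    intro E hE
    rcases hE with rfl | hE
    · exact Or.inr (h Q' B ρ (Finset.subset_union_right.trans hQ') hB
        (fun E hE => hn E (Finset.mem_union_right _ hE)) hS)
    · exact hS E hE

theorem RMADerivation.exists_charges {ℓ m n t : ℕ} (c : ℕ) (hℓ : 2 ≤ ℓ) (ht : 2 ≤ t)
    (π : RMARefutation (formula ℓ m n)) :
    ∃ (L : Finset (Clause FVar)) (Q : Charges), L.card ≤ 2 * π.length + 1 ∧ Q.card ≤ π.length ∧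
      ∀ B ρ, Spread ℓ (c + t) B → Narrow t B ρ L → ∀ a < m, Good ℓ n c Q a := by
  obtain ⟨L, Q, hL, hQ, h⟩ := π.lemmas.exists_charges c hℓ ht
  obtain ⟨L₁, hL₁, ⟨R, -, h₁, -⟩ | ⟨Q₁, hQ₁, h₁⟩⟩ := π.last.exists_charges ℓ m n c t
  · obtain ⟨j, a, b, h₁, -⟩ := h₁
    exact absurd h₁.symm (Finset.insert_ne_empty _ _)
  refine ⟨L ∪ L₁, Q ∪ Q₁, (Finset.card_union_le _ _).trans ?_,
    (Finset.card_union_le _ _).trans ?_, ?_⟩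
  · simp only [RMADerivation.length]; omega
  · simp only [RMADerivation.length]; omega
  intro B ρ hB hn a ha
  refine (h₁ (Q ∪ Q₁) B ρ Finset.subset_union_right hB
    (fun E hE => hn E (Finset.mem_union_right _ hE))
    (h (Q ∪ Q₁) B ρ Finset.subset_union_left hB
      fun E hE => hn E (Finset.mem_union_left _ hE))).far a ha ?_ ?_
  · simp [Alive]
  · simp [Far, CutFalse]

/-! ### Counting charges -/

-- The cuts falsifying `E` form an interval, so it covers any block strictly between two others that
-- it meets.
open Classical in
theorem card_charged_le {ℓ m j : ℕ} (hj : 1 ≤ j) (hjl : j ≤ ℓ) (E : Clause FVar) :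
    ((Finset.range m).filter fun a => CutFalse (a * ℓ + j) E ∧ ¬ Far ℓ a E).card ≤ 2 := by
  set s := (Finset.range m).filter fun a => CutFalse (a * ℓ + j) E ∧ ¬ Far ℓ a E with hs
  rcases s.eq_empty_or_nonempty with h | h
  · simp [h]
  refine (Finset.card_le_card (t := {s.min' h, s.max' h}) ?_).trans Finset.card_le_two
  intro a ha
  by_contra hne
  simp only [Finset.mem_insert, Finset.mem_singleton, not_or] at hne
  have h1 := lt_of_le_of_ne (s.min'_le a ha) (Ne.symm hne.1)
  have h2 := lt_of_le_of_ne (s.le_max' a ha) hne.2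
  have c1 := (Finset.mem_filter.1 (s.min'_mem h)).2.1
  have c2 := (Finset.mem_filter.1 (s.max'_mem h)).2.1
  refine (Finset.mem_filter.1 ha).2.2 fun j' hj' hjl' => ?_
  have e1 := Nat.mul_le_mul_right ℓ (Nat.succ_le_of_lt h1)
  have e2 := Nat.mul_le_mul_right ℓ (Nat.succ_le_of_lt h2)
  rw [Nat.succ_mul] at e1 e2
  refine ⟨fun v hv => ?_, fun v hv => ?_⟩
  · have := c2.1 v hv; omega
  · have := c1.2 v hv; omega

/-- Double counting of the charged triples `(a, j, k)`: a charge fixes `j` and `k` and leaves at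
most two values of `a`. -/
theorem mul_le_card_charges {ℓ m n c : ℕ} {Q : Charges} (h : ∀ a < m, Good ℓ n c Q a) :
    m * (c * (n - 1)) ≤ 2 * Q.card := by
  classical
  choose! s hs hc hch using h
  let T : Finset (Σ _ : ℕ, ℕ × ℕ) :=
    (Finset.range m).sigma fun a => s a ×ˢ Finset.Ico 1 n
  have h1 : m * (c * (n - 1)) ≤ T.card := by
    simp only [T, Finset.card_sigma, Finset.card_product, Nat.card_Ico]
    calc m * (c * (n - 1)) = ∑ a ∈ Finset.range m, c * (n - 1) := by simp
      _ ≤ _ := Finset.sum_le_sum fun a ha =>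
        Nat.mul_le_mul_right _ (hc a (Finset.mem_range.1 ha))
  have h2 : T ⊆ (Q.filter fun q => 1 ≤ q.1 ∧ q.1 ≤ ℓ).biUnion fun q =>
      ((Finset.range m).filter fun a =>
        CutFalse (a * ℓ + q.1) q.2.2 ∧ ¬ Far ℓ a q.2.2).image fun a => ⟨a, q.1, q.2.1⟩ := by
    rintro ⟨a, j, k⟩ hx
    simp only [T, Finset.mem_sigma, Finset.mem_range, Finset.mem_product, Finset.mem_Ico] at hx
    obtain ⟨ha, hj, hk⟩ := hx
    obtain ⟨E, hE, hE'⟩ := hch a ha j hj k hk.1 hk.2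
    refine Finset.mem_biUnion.2 ⟨(j, k, E), Finset.mem_filter.2 ⟨hE, ?_⟩, ?_⟩
    · simpa using hs a ha hj
    · exact Finset.mem_image.2 ⟨a, Finset.mem_filter.2 ⟨Finset.mem_range.2 ha, hE'⟩, rfl⟩
  calc m * (c * (n - 1)) ≤ T.card := h1
    _ ≤ _ := Finset.card_le_card h2
    _ ≤ (Q.filter fun q => 1 ≤ q.1 ∧ q.1 ≤ ℓ).card * 2 := by
      refine Finset.card_biUnion_le_card_mul _ _ _ fun q hq => ?_
      have := (Finset.mem_filter.1 hq).2
      exact Finset.card_image_le.trans (card_charged_le this.1 this.2 _)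
    _ ≤ 2 * Q.card := by
      rw [mul_comm]
      exact Nat.mul_le_mul_left 2 (Finset.card_filter_le _ _)

/-! ### Choosing the free blocks and the signs -/

/-- The set with exactly one element in each pair `{2s, 2s + 1}`, selected by `ω`. -/
def freeBlocks (ω : ℕ → Bool × Bool) : Set ℕ := {j | (ω (j / 2)).1 = decide (j % 2 = 1)}

/-- The sign of a block that is not free. -/
def blockSign (ω : ℕ → Bool × Bool) (j : ℕ) : Bool := (ω (j / 2)).2

/-- Each pair inside the interval contributes an element whatever `ω` is, so chance is needed only
for narrowness. -/
theorem spread_freeBlocks {ℓ N : ℕ} (h : 4 * N + 4 ≤ ℓ) (ω : ℕ → Bool × Bool) :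
    Spread ℓ N (freeBlocks ω) := by
  intro u v _ _ huv
  have hdiv : ∀ s, (2 * s + (ω s).1.toNat) / 2 = s ∧
      (2 * s + (ω s).1.toNat) % 2 = (ω s).1.toNat := fun s => by
    have := Bool.toNat_lt (ω s).1
    omega
  refine ⟨(Finset.Ico ((u + 1) / 2) ((v + 1) / 2)).image fun s => 2 * s + (ω s).1.toNat,
    ?_, ?_, ?_⟩
  · intro j hj
    obtain ⟨s, hs, rfl⟩ := Finset.mem_image.1 hj
    have := Finset.mem_Ico.1 hs
    have := Bool.toNat_lt (ω s).1
    exact Finset.mem_Icc.2 ⟨by omega, by omega⟩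
  · intro j hj
    obtain ⟨s, hs, rfl⟩ := Finset.mem_image.1 hj
    simp only [freeBlocks, Set.mem_ofPred_eq, (hdiv s).1, (hdiv s).2]
    cases (ω s).1 <;> simp
  · rw [Finset.card_image_of_injective, Nat.card_Ico]
    · omega
    · intro s s' hss
      rw [← (hdiv s).1, ← (hdiv s').1]
      exact congrArg (· / 2) hss

/-- The choices for the pair `{2s, 2s + 1}` that are compatible with signs `f` on `J`. -/
def pairChoices (J : Finset ℕ) (f : ℕ → Bool) (s : ℕ) : Finset (Bool × Bool) :=
  Finset.univ.filter fun o => ∀ j ∈ J, j / 2 = s → o.1 = decide (j % 2 = 1) ∨ f j = o.2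

/-- One of the four choices kills a given chain: not free, wrong sign. For the two chains of a pair
these choices differ, leaving `1/2 ≤ (3/4)^2`. -/
theorem card_pairChoices_mul_le (J : Finset ℕ) (f : ℕ → Bool) (s : ℕ) :
    (pairChoices J f s).card * 4 ^ (J.filter fun j => j / 2 = s).card ≤
      4 * 3 ^ (J.filter fun j => j / 2 = s).card := by
  have h1 : pairChoices J f s ⊆ Finset.univ.filter fun o : Bool × Bool =>
      (2 * s ∈ J → o.1 = false ∨ f (2 * s) = o.2) ∧
        (2 * s + 1 ∈ J → o.1 = true ∨ f (2 * s + 1) = o.2) := by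
    intro o ho
    have ho := (Finset.mem_filter.1 ho).2
    refine Finset.mem_filter.2 ⟨Finset.mem_univ _, fun h => ?_, fun h => ?_⟩
    · simpa using ho _ h (by omega)
    · have : (2 * s + 1) % 2 = 1 := by omega
      simpa [this] using ho _ h (by omega)
  have h2 : (J.filter fun j => j / 2 = s) =
      ({2 * s, 2 * s + 1} : Finset ℕ).filter (· ∈ J) := by
    ext j
    simp only [Finset.mem_filter, Finset.mem_insert, Finset.mem_singleton]
    constructor
    · rintro ⟨h, h'⟩; exact ⟨by omega, h⟩
    · rintro ⟨h, h'⟩; exact ⟨h', by omega⟩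
  refine (Nat.mul_le_mul_right _ (Finset.card_le_card h1)).trans ?_
  rw [h2, Finset.filter_insert, Finset.filter_singleton]
  generalize f (2 * s) = x
  generalize f (2 * s + 1) = y
  by_cases e1 : 2 * s ∈ J <;> by_cases e2 : 2 * s + 1 ∈ J <;>
    simp only [e1, e2, if_true, if_false, true_imp_iff, false_imp_iff, and_true, true_and]
  · rw [Finset.card_pair (by omega)]
    revert x y; decide
  · rw [insert_empty_eq, Finset.card_singleton]
    revert x; decide
  · rw [Finset.card_singleton]
    revert y; decide
  · rw [Finset.card_empty]
    decide

/-- The extension of finitely many choices to all pairs. -/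
def extendChoice {h : ℕ} (ω : Fin h → Bool × Bool) (s : ℕ) : Bool × Bool :=
  if hs : s < h then ω ⟨s, hs⟩ else (true, true)

-- The choices for different pairs are independent, so the bounds for the pairs multiply.
open Classical in
theorem card_alive_mul_le {h : ℕ} (E : Clause FVar) (hE : ∀ j ∈ blocksOf E, j / 2 < h) :
    (Finset.univ.filter fun ω : Fin h → Bool × Bool =>
        Alive (freeBlocks (extendChoice ω)) (blockSign (extendChoice ω)) E).card *
      4 ^ (blocksOf E).card ≤ 4 ^ h * 3 ^ (blocksOf E).card := by
  -- One occurring sign per chain is enough for an upper bound.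
  have hf : ∀ j, ∃ s, j ∈ blocksOf E → ∃ k, (FVar.w j k, s) ∈ E := fun j => by
    by_cases hj : j ∈ blocksOf E
    · obtain ⟨k, s, hs⟩ := mem_blocksOf.1 hj
      exact ⟨s, fun _ => ⟨k, hs⟩⟩
    · exact ⟨true, fun h => absurd h hj⟩
  choose f hf using hf
  have hsub : (Finset.univ.filter fun ω : Fin h → Bool × Bool =>
      Alive (freeBlocks (extendChoice ω)) (blockSign (extendChoice ω)) E) ⊆
      Fintype.piFinset fun s : Fin h => pairChoices (blocksOf E) f s := by
    intro ω hω
    have hω := (Finset.mem_filter.1 hω).2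
    refine Fintype.mem_piFinset.2 fun s => Finset.mem_filter.2 ⟨Finset.mem_univ _, ?_⟩
    intro j hj hjs
    obtain ⟨k, hk⟩ := hf j hj
    have := hω j k _ hk
    simpa [freeBlocks, blockSign, extendChoice, hjs] using this
  have hsum : (blocksOf E).card = ∑ s : Fin h, ((blocksOf E).filter fun j => j / 2 = (s : ℕ)).card := by
    rw [Fin.sum_univ_eq_sum_range fun s => ((blocksOf E).filter fun j => j / 2 = s).card]
    exact Finset.card_eq_sum_card_fiberwise fun j hj => by simpa using hE j hj
  calc _ ≤ (∏ s : Fin h, (pairChoices (blocksOf E) f s).card) * 4 ^ (blocksOf E).card := by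
        refine Nat.mul_le_mul_right _ ((Finset.card_le_card hsub).trans ?_)
        rw [Fintype.card_piFinset]
    _ = ∏ s : Fin h, (pairChoices (blocksOf E) f s).card *
          4 ^ ((blocksOf E).filter fun j => j / 2 = (s : ℕ)).card := by
        rw [hsum, Finset.prod_mul_distrib, Finset.prod_pow_eq_pow_sum]
    _ ≤ ∏ s : Fin h, 4 * 3 ^ ((blocksOf E).filter fun j => j / 2 = (s : ℕ)).card :=
        Finset.prod_le_prod' fun s _ => card_pairChoices_mul_le _ _ _
    _ = 4 ^ h * 3 ^ (blocksOf E).card := by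
        rw [hsum, Finset.prod_mul_distrib, Finset.prod_pow_eq_pow_sum]
        simp

/-- Union bound over the clauses of `L` that mention at least `t` chains. -/
theorem exists_narrow {t : ℕ} (L : Finset (Clause FVar)) (hL : L.card * 3 ^ t < 4 ^ t) :
    ∃ ω, Narrow t (freeBlocks ω) (blockSign ω) L := by
  classical
  by_contra hno
  push Not at hno
  obtain ⟨h, hh⟩ : ∃ h, ∀ E ∈ L, ∀ j ∈ blocksOf E, j / 2 < h := by
    refine ⟨(L.biUnion blocksOf).sup id + 1, fun E hE j hj => ?_⟩
    have : j ≤ (L.biUnion blocksOf).sup id :=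
      Finset.le_sup (f := id) (Finset.mem_biUnion.2 ⟨E, hE, hj⟩)
    omega
  let A : Clause FVar → Finset (Fin h → Bool × Bool) := fun E =>
    Finset.univ.filter fun ω =>
      Alive (freeBlocks (extendChoice ω)) (blockSign (extendChoice ω)) E
  have hcover : (Finset.univ : Finset (Fin h → Bool × Bool)) ⊆
      (L.filter fun E => t ≤ (blocksOf E).card).biUnion A := by
    intro ω _
    have := hno (extendChoice ω)
    simp only [Narrow] at this
    push Not at this
    obtain ⟨E, hE, hal, hc⟩ := this
    exact Finset.mem_biUnion.2 ⟨E, Finset.mem_filter.2 ⟨hE, hc⟩,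
      Finset.mem_filter.2 ⟨Finset.mem_univ _, hal⟩⟩
  have hA : ∀ E ∈ L.filter fun E => t ≤ (blocksOf E).card,
      (A E).card * 4 ^ t ≤ 4 ^ h * 3 ^ t := by
    intro E hE
    obtain ⟨hE, hc⟩ := Finset.mem_filter.1 hE
    have h1 := card_alive_mul_le E (hh E hE)
    -- The `r` surplus chains only help, as `3 ^ r ≤ 4 ^ r`.
    obtain ⟨r, hr⟩ := Nat.exists_eq_add_of_le hc
    rw [hr, pow_add, pow_add, ← mul_assoc, ← mul_assoc] at h1
    refine Nat.le_of_mul_le_mul_right (h1.trans ?_) (pow_pos (by norm_num : 0 < 4) r)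
    exact Nat.mul_le_mul_left _ (Nat.pow_le_pow_left (by norm_num) r)
  have h4 : 4 ^ h * 4 ^ t ≤ 4 ^ h * (L.card * 3 ^ t) := by
    calc 4 ^ h * 4 ^ t = (Finset.univ : Finset (Fin h → Bool × Bool)).card * 4 ^ t := by simp
      _ ≤ (∑ E ∈ L.filter fun E => t ≤ (blocksOf E).card, (A E).card) * 4 ^ t :=
        Nat.mul_le_mul_right _ ((Finset.card_le_card hcover).trans Finset.card_biUnion_le)
      _ = ∑ E ∈ L.filter fun E => t ≤ (blocksOf E).card, (A E).card * 4 ^ t := Finset.sum_mul ..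
      _ ≤ ∑ E ∈ L.filter fun E => t ≤ (blocksOf E).card, 4 ^ h * 3 ^ t := Finset.sum_le_sum hA
      _ ≤ L.card * (4 ^ h * 3 ^ t) := by
        rw [Finset.sum_const, smul_eq_mul]
        exact Nat.mul_le_mul_right _ (Finset.card_filter_le _ _)
      _ = 4 ^ h * (L.card * 3 ^ t) := by ring
  exact absurd (Nat.le_of_mul_le_mul_left h4 (pow_pos (by norm_num) h)) (not_le.2 hL)

theorem mul_le_length_of_refutation {ℓ m n c t : ℕ} (ht : 2 ≤ t) (hℓ : 4 * (c + t) + 4 ≤ ℓ)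
    (π : RMARefutation (formula ℓ m n)) (hπ : (2 * π.length + 1) * 3 ^ t < 4 ^ t) :
    m * (c * (n - 1)) ≤ 2 * π.length := by
  obtain ⟨L, Q, hL, hQ, h⟩ := RMADerivation.exists_charges c (by omega) ht π
  obtain ⟨ω, hω⟩ := exists_narrow L ((Nat.mul_le_mul_right _ hL).trans_lt hπ)
  have := mul_le_card_charges (h _ _ (spread_freeBlocks hℓ ω) hω)
  omega

/-! ### Numerical estimates and the lower bound -/

theorem one_le_logb {n : ℕ} (hn : 2 ≤ n) : 1 ≤ Real.logb 2 n := by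
  rw [Real.le_logb_iff_rpow_le (by norm_num) (by positivity)]
  simpa using (by exact_mod_cast hn : (2 : ℝ) ≤ n)

theorem logb_le_self {n : ℕ} (hn : 2 ≤ n) : Real.logb 2 n ≤ n := by
  rw [Real.logb_le_iff_le_rpow (by norm_num) (by positivity), Real.rpow_natCast]
  exact_mod_cast Nat.lt_two_pow_self.le

/-- The constant `8` works because `(4/3)^8 > 8 = 2^3`. -/
theorem cube_mul_three_pow_lt {n t : ℕ} (hn : 2 ≤ n) (ht : 8 * Real.logb 2 n ≤ t) :
    n ^ 3 * 3 ^ t < 4 ^ t := by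
  have h1 := one_le_logb hn
  have hn0 : (0 : ℝ) < n := by positivity
  have h2 : ((n : ℝ)) ^ 3 < (4 / 3 : ℝ) ^ t := by
    calc (n : ℝ) ^ 3 = ((2 : ℝ) ^ Real.logb 2 n) ^ (3 : ℕ) := by
          rw [Real.rpow_logb (by norm_num) (by norm_num) hn0]
      _ = (8 : ℝ) ^ Real.logb 2 n := by
          rw [← Real.rpow_natCast, ← Real.rpow_mul (by norm_num), mul_comm,
            Real.rpow_mul (by norm_num)]
          norm_num
      _ < ((4 / 3 : ℝ) ^ (8 : ℝ)) ^ Real.logb 2 n :=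
          Real.rpow_lt_rpow (by norm_num) (by norm_num) (by linarith)
      _ = (4 / 3 : ℝ) ^ (8 * Real.logb 2 n) := (Real.rpow_mul (by norm_num) _ _).symm
      _ ≤ (4 / 3 : ℝ) ^ (t : ℝ) := Real.rpow_le_rpow_of_exponent_le (by norm_num) ht
      _ = _ := Real.rpow_natCast _ _
  rw [div_pow, lt_div_iff₀ (by positivity)] at h2
  exact_mod_cast h2

theorem le_length_of_refutation {n : ℕ} (hn : 2 ≤ n) (π : RMARefutation (separatingFormula n)) :
    1 / 8 * ((n : ℝ) ^ 2 * Real.logb 2 n) ≤ π.length := by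
  by_contra! hlt
  set x := Real.logb 2 (n : ℝ) with hx
  have h1 : 1 ≤ x := one_le_logb hn
  have h2 : x ≤ n := logb_le_self hn
  have hnr : (2 : ℝ) ≤ n := by exact_mod_cast hn
  have c1 := Nat.le_ceil x
  have t1 := Nat.le_ceil (8 * x)
  have c2 := Nat.ceil_lt_add_one (by linarith : 0 ≤ x)
  have t2 := Nat.ceil_lt_add_one (by linarith : 0 ≤ 8 * x)
  have ℓ1 := Nat.le_ceil (48 * x)
  -- For `c = ⌈x⌉` and `t = ⌈8x⌉`, `4(c + t) + 4 ≤ 36x + 12 ≤ 48x` since `x ≥ 1`.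
  have key : n * (⌈x⌉₊ * (n - 1)) ≤ 2 * π.length := by
    refine mul_le_length_of_refutation (t := ⌈8 * x⌉₊) ?_ ?_ π ?_
    · have : (2 : ℝ) ≤ ⌈8 * x⌉₊ := by linarith
      exact_mod_cast this
    · have : (4 * (⌈x⌉₊ + ⌈8 * x⌉₊) + 4 : ℝ) ≤ ⌈48 * x⌉₊ := by linarith
      exact_mod_cast this
    · refine lt_of_le_of_lt (Nat.mul_le_mul_right _ ?_) (cube_mul_three_pow_lt hn t1)
      have : (2 * π.length + 1 : ℝ) ≤ n ^ 3 := by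
        have : (n : ℝ) ^ 2 * x ≤ n ^ 2 * n := by gcongr
        have : (8 : ℝ) ≤ n ^ 3 := by
          calc (8 : ℝ) = 2 ^ 3 := by norm_num
            _ ≤ n ^ 3 := by gcongr
        nlinarith
      exact_mod_cast this
  have key' : (n : ℝ) * (⌈x⌉₊ * (n - 1)) ≤ 2 * π.length := by
    have : ((n - 1 : ℕ) : ℝ) = n - 1 := by push_cast [Nat.cast_sub (by omega : 1 ≤ n)]; rfl
    rw [← this]
    exact_mod_cast key
  have : (n : ℝ) * (x * (n / 2)) ≤ n * (⌈x⌉₊ * (n - 1)) := by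
    gcongr
    linarith
  nlinarith [mul_pos (by positivity : (0 : ℝ) < n ^ 2) (by linarith : 0 < x)]

/-! ### Size and resolution refutation of the formula -/

theorem mem_formula {ℓ m n : ℕ} {C : Clause FVar} : C ∈ formula ℓ m n ↔
    (∃ j k b, (1 ≤ j ∧ j ≤ ℓ) ∧ (1 ≤ k ∧ k < n) ∧ clauseB j k b = C) ∨
      ∃ i b, (1 ≤ i ∧ i ≤ m * ℓ) ∧ clauseA ℓ m n i b = C := by
  simp [formula, and_assoc]

theorem blockIndex_mem {ℓ : ℕ} (hℓ : 1 ≤ ℓ) (i : ℕ) :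
    1 ≤ blockIndex ℓ i ∧ blockIndex ℓ i ≤ ℓ :=
  ⟨Nat.le_add_left _ _, Nat.mod_lt _ hℓ⟩

theorem card_vars_formula_le {ℓ m n : ℕ} (hℓ : 1 ≤ ℓ) (hn : 1 ≤ n) :
    (formula ℓ m n).vars.card ≤ ℓ * n + (m * ℓ + 1) := by
  have hsub : (formula ℓ m n).vars ⊆
      ((Finset.Icc 1 ℓ ×ˢ Finset.Icc 1 n).image fun t => FVar.w t.1 t.2) ∪
        (Finset.range (m * ℓ + 1)).image FVar.x := by
    intro v hv
    obtain ⟨C, hC, hv⟩ := Finset.mem_biUnion.1 hv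
    obtain ⟨l, hl, rfl⟩ := Finset.mem_image.1 hv
    simp only [Finset.mem_union, Finset.mem_image, Finset.mem_product, Finset.mem_Icc,
      Finset.mem_range, Prod.exists]
    rcases mem_formula.1 hC with ⟨j, k, b, hj, hk, rfl⟩ | ⟨i, b, hi, rfl⟩
    · simp only [clauseB, Finset.mem_insert, Finset.mem_singleton] at hl
      rcases hl with rfl | rfl
      · exact Or.inl ⟨j, k, ⟨hj, by omega⟩, rfl⟩
      · exact Or.inl ⟨j, k + 1, ⟨hj, by omega⟩, rfl⟩
    · rcases mem_clauseA.1 hl with rfl | rfl | ⟨-, rfl⟩ | ⟨-, rfl⟩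
      · exact Or.inl ⟨_, 1, ⟨blockIndex_mem hℓ i, by omega⟩, rfl⟩
      · exact Or.inl ⟨_, n, ⟨blockIndex_mem hℓ i, by omega⟩, rfl⟩
      · exact Or.inr ⟨i - 1, by omega, rfl⟩
      · exact Or.inr ⟨i, by omega, rfl⟩
  refine (Finset.card_le_card hsub).trans ((Finset.card_union_le _ _).trans ?_)
  refine Nat.add_le_add (Finset.card_image_le.trans ?_) (Finset.card_image_le.trans ?_) <;> simp

theorem card_formula_le (ℓ m n : ℕ) :
    (formula ℓ m n).card ≤ ℓ * ((n - 1) * 2) + m * ℓ * 2 := by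
  refine (Finset.card_union_le _ _).trans (Nat.add_le_add (Finset.card_image_le.trans ?_)
    (Finset.card_image_le.trans ?_)) <;> simp

theorem IsResolutionDerivation.concat {F : CNF FVar} {η : List (Clause FVar)}
    (h : IsResolutionDerivation F η) {C : Clause FVar}
    (hC : C ∈ F ∨ ∃ D ∈ η, ∃ E ∈ η, ∃ p, Resolvable p D E ∧ C = resolvent p D E) :
    IsResolutionDerivation F (η ++ [C]) := by
  rintro ⟨i, hi⟩
  have hlen : (η ++ [C]).length = η.length + 1 := by simp
  have get_left : ∀ (k : ℕ) (hk : k < η.length),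
      (η ++ [C]).get ⟨k, by omega⟩ = η.get ⟨k, hk⟩ := fun k hk => by
    simp [List.getElem_append_left hk]
  rcases Nat.lt_or_ge i η.length with hi' | hi'
  · rw [get_left i hi']
    refine (h ⟨i, hi'⟩).imp_right ?_
    rintro ⟨⟨j, hj⟩, ⟨k, hk⟩, hji, hki, p, hp⟩
    refine ⟨⟨j, by omega⟩, ⟨k, by omega⟩, hji, hki, p, ?_⟩
    rwa [get_left j hj, get_left k hk]
  · obtain rfl : i = η.length := by omega
    have hlast : (η ++ [C]).get ⟨η.length, hi⟩ = C := by simp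
    rw [hlast]
    refine hC.imp_right ?_
    rintro ⟨D, hD, E, hE, p, hp⟩
    obtain ⟨⟨j, hj⟩, rfl⟩ := List.mem_iff_get.1 hD
    obtain ⟨⟨k, hk⟩, rfl⟩ := List.mem_iff_get.1 hE
    refine ⟨⟨j, by omega⟩, ⟨k, by omega⟩, hj, hk, p, ?_⟩
    rwa [get_left j hj, get_left k hk]

/-- Allows a derivation to be cut off right after the empty clause. -/
theorem IsResolutionDerivation.of_append {F : CNF FVar} {η θ : List (Clause FVar)}
    (h : IsResolutionDerivation F (η ++ θ)) : IsResolutionDerivation F η := by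
  rintro ⟨i, hi⟩
  have hlen : (η ++ θ).length = η.length + θ.length := by simp
  have get_left : ∀ (k : ℕ) (hk : k < η.length),
      (η ++ θ).get ⟨k, by omega⟩ = η.get ⟨k, hk⟩ := fun k hk => by
    simp [List.getElem_append_left hk]
  have := h ⟨i, by omega⟩
  rw [get_left i hi] at this
  refine this.imp_right ?_
  rintro ⟨⟨j, hj⟩, ⟨k, hk⟩, hji, hki, p, hp⟩
  have hj' : j < i := hji
  have hk' : k < i := hki
  refine ⟨⟨j, by omega⟩, ⟨k, by omega⟩, hji, hki, p, ?_⟩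
  rwa [get_left j (by omega), get_left k (by omega)] at hp

/-- All clauses of `T` occur in some resolution derivation of length at most `N`. -/
def DerivableIn (F : CNF FVar) (T : Set (Clause FVar)) (N : ℕ) : Prop :=
  ∃ η, IsResolutionDerivation F η ∧ (∀ C ∈ T, C ∈ η) ∧ η.length ≤ N

namespace DerivableIn
variable {F : CNF FVar} {T T' : Set (Clause FVar)} {N N' : ℕ}

theorem empty (F : CNF FVar) : DerivableIn F ∅ 0 :=
  ⟨[], fun i => i.elim0, by simp, le_rfl⟩

theorem mono (h : DerivableIn F T N) (hT : T' ⊆ T) (hN : N ≤ N') : DerivableIn F T' N' := by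
  obtain ⟨η, h1, h2, h3⟩ := h
  exact ⟨η, h1, fun C hC => h2 C (hT hC), h3.trans hN⟩

theorem insert_initial (h : DerivableIn F T N) {C : Clause FVar} (hC : C ∈ F) :
    DerivableIn F (insert C T) (N + 1) := by
  obtain ⟨η, h1, h2, h3⟩ := h
  refine ⟨η ++ [C], h1.concat (Or.inl hC), ?_, by simpa using h3⟩
  rintro D (rfl | hD)
  · simp
  · simp [h2 D hD]

theorem insert_resolvent (h : DerivableIn F T N) {C D E : Clause FVar} (p : Literal FVar)
    (hD : D ∈ T) (hE : E ∈ T) (hp : Resolvable p D E) (hC : C = resolvent p D E) :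
    DerivableIn F (insert C T) (N + 1) := by
  obtain ⟨η, h1, h2, h3⟩ := h
  refine ⟨η ++ [C], h1.concat (Or.inr ⟨D, h2 D hD, E, h2 E hE, p, hp, hC⟩), ?_,
    by simpa using h3⟩
  rintro D (rfl | hD)
  · simp
  · simp [h2 D hD]

end DerivableIn

/-! ### The short resolution refutation -/

/-- The clause `w_{j,1} ∨ ¬w_{j,k}`, respectively `¬w_{j,1} ∨ w_{j,k}`. -/
def clauseChain (j k : ℕ) (b : Bool) : Clause FVar := {(.w j 1, b), (.w j k, !b)}

theorem derivableIn_chain {ℓ m n : ℕ} {T : Set (Clause FVar)} {N j : ℕ}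
    (h : DerivableIn (formula ℓ m n) T N) (hj : 1 ≤ j) (hjl : j ≤ ℓ) (b : Bool) (k : ℕ)
    (hk : k + 2 ≤ n) :
    DerivableIn (formula ℓ m n) (insert (clauseChain j (k + 2) b) T) (N + 2 * (k + 1)) := by
  induction k with
  | zero =>
    exact (h.insert_initial (C := clauseChain j 2 b)
      (mem_formula.2 (Or.inl ⟨j, 1, b, ⟨hj, hjl⟩, by omega, rfl⟩))).mono subset_rfl (by omega)
  | succ k ih =>
    have h1 := (ih (by omega)).insert_initial (C := clauseB j (k + 2) b)
      (mem_formula.2 (Or.inl ⟨j, k + 2, b, ⟨hj, hjl⟩, by omega, rfl⟩))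
    refine (h1.insert_resolvent (C := clauseChain j (k + 3) b) (.w j (k + 2), !b)
      (Set.mem_insert_of_mem _ (Set.mem_insert _ _)) (Set.mem_insert _ _) ?_ ?_).mono
      (Set.insert_subset_insert fun C hC =>
        Set.mem_insert_of_mem _ (Set.mem_insert_of_mem _ hC)) (by omega)
    · simp [Resolvable, clauseChain, clauseB, Literal.neg]
    · ext ⟨v, s⟩
      simp only [clauseChain, clauseB, resolvent, Literal.neg, Finset.mem_insert,
        Finset.mem_singleton, Finset.mem_union, Finset.mem_erase, Bool.not_not]
      cases b <;> grind

theorem derivableIn_chains {ℓ m n : ℕ} (hn : 2 ≤ n) (j : ℕ) (hj : j ≤ ℓ) :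
    DerivableIn (formula ℓ m n)
      {C | ∃ j' b, 1 ≤ j' ∧ j' ≤ j ∧ C = clauseChain j' n b} (4 * n * j) := by
  induction j with
  | zero =>
    refine (DerivableIn.empty _).mono ?_ (by omega)
    rintro C ⟨j', b, h1, h2, -⟩
    omega
  | succ j ih =>
    obtain ⟨k, rfl⟩ := Nat.exists_eq_add_of_le' hn
    refine (derivableIn_chain (derivableIn_chain (ih (by omega)) (by omega) hj true k le_rfl)
      (by omega) hj false k le_rfl).mono ?_ (by ring_nf; omega)
    rintro C ⟨j', b, h1, h2, rfl⟩
    rcases Nat.lt_or_ge j j' with h | h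
    · obtain rfl : j' = j + 1 := by omega
      cases b <;> simp
    · exact Set.mem_insert_of_mem _ (Set.mem_insert_of_mem _ ⟨j', b, h1, h, rfl⟩)

/-- Five lines: both clauses `A_{i,b}`, each resolved with a chain implication to trade `w_{j,1}`
for `w_{j,n}`, and the resolvent of the results on `w_{j,n}`. -/
theorem derivableIn_step {ℓ m n i N : ℕ} {T : Set (Clause FVar)}
    (hi : 1 ≤ i) (him : i ≤ m * ℓ) (h : DerivableIn (formula ℓ m n) T N)
    (hT : ∀ b, clauseChain (blockIndex ℓ i) n b ∈ T) :
    DerivableIn (formula ℓ m n) (insert (negX (i - 1) ∪ posX (m * ℓ) i) T) (N + 5) := by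
  set X := negX (i - 1) ∪ posX (m * ℓ) i with hX
  have hw : ∀ j k s, (FVar.w j k, s) ∉ X := by
    simp [hX, mem_negX, mem_posX]
  set j := blockIndex ℓ i with hj
  have hA : ∀ b, clauseA ℓ m n i b = {(.w j 1, b), (.w j n, b)} ∪ X := fun b => by
    rw [clauseA, Finset.union_assoc]
  have stepA : ∀ {T : Set (Clause FVar)} {N : ℕ} (b : Bool), DerivableIn (formula ℓ m n) T N →
      clauseChain j n (!b) ∈ T →
      DerivableIn (formula ℓ m n) (insert (insert (.w j n, b) X) T) (N + 2) := by
    intro T N b h hT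
    refine ((h.insert_initial (mem_formula.2 (Or.inr ⟨i, b, ⟨hi, him⟩, rfl⟩))).insert_resolvent
      (C := insert (.w j n, b) X) (.w j 1, b) (Set.mem_insert _ _) (Set.mem_insert_of_mem _ hT)
      ?_ ?_).mono (Set.insert_subset_insert (Set.subset_insert _ _)) le_rfl
    · simp [Resolvable, hA, clauseChain, Literal.neg]
    · rw [hA]
      ext ⟨v, s⟩
      have := hw j 1 b
      simp only [clauseChain, resolvent, Literal.neg, Finset.mem_insert,
        Finset.mem_singleton, Finset.mem_union, Finset.mem_erase, Bool.not_not]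
      grind
  refine ((stepA false (stepA true h (hT _)) (Set.mem_insert_of_mem _ (hT _))).insert_resolvent
    (C := X) (.w j n, true) (Set.mem_insert_of_mem _ (Set.mem_insert _ _)) (Set.mem_insert _ _)
    ?_ ?_).mono (Set.insert_subset_insert ((Set.subset_insert _ _).trans (Set.subset_insert _ _)))
    le_rfl
  · simp [Resolvable, Literal.neg]
  · simp [resolvent, Literal.neg, hw]

/-- Unit propagation along the `x_i`, six lines per index, with the chain implications shared by all
of them. -/
theorem derivableIn_posX {ℓ m n : ℕ} (hℓ : 1 ≤ ℓ) (hn : 2 ≤ n) (i : ℕ) (him : i + 1 ≤ m * ℓ) :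
    DerivableIn (formula ℓ m n)
      (insert (posX (m * ℓ) (i + 1)) {C | ∃ j b, 1 ≤ j ∧ j ≤ ℓ ∧ C = clauseChain j n b})
      (4 * n * ℓ + 6 * (i + 1)) := by
  have hchain : ∀ i b, clauseChain (blockIndex ℓ i) n b ∈
      {C | ∃ j b, 1 ≤ j ∧ j ≤ ℓ ∧ C = clauseChain j n b} := fun i b =>
    ⟨_, b, (blockIndex_mem hℓ i).1, (blockIndex_mem hℓ i).2, rfl⟩
  induction i with
  | zero =>
    have := derivableIn_step (i := 1) le_rfl him (derivableIn_chains hn ℓ le_rfl) (hchain 1)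
    simp only [negX, Nat.sub_self, if_true, Finset.empty_union] at this
    exact this.mono subset_rfl (by omega)
  | succ i ih =>
    have h1 := derivableIn_step (i := i + 2) (by omega) him (ih (by omega))
      fun b => Set.mem_insert_of_mem _ (hchain _ b)
    have e1 : posX (m * ℓ) (i + 1) = {(.x (i + 1), true)} := by
      rw [posX, if_neg (by omega)]
    have e2 : negX (i + 2 - 1) = {(.x (i + 1), false)} := by
      rw [negX, if_neg (by omega)]; rfl
    refine (h1.insert_resolvent (C := posX (m * ℓ) (i + 2)) (.x (i + 1), true)
      (Set.mem_insert_of_mem _ (Set.mem_insert _ _)) (Set.mem_insert _ _) ?_ ?_).mono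
      (Set.insert_subset_insert ((Set.subset_insert _ _).trans (Set.subset_insert _ _)))
      (by omega)
    · rw [e1, e2]; simp [Resolvable, Literal.neg]
    · rw [e1, e2]
      have : (FVar.x (i + 1), false) ∉ posX (m * ℓ) (i + 2) := by simp [mem_posX]
      simp [resolvent, Literal.neg, this]

theorem exists_resolutionRefutation {ℓ m n : ℕ} (hℓ : 1 ≤ ℓ) (hm : 1 ≤ m) (hn : 2 ≤ n) :
    ∃ η, IsResolutionRefutation (formula ℓ m n) η ∧ η.length ≤ 4 * n * ℓ + 6 * (m * ℓ) := by
  have hpos : 1 ≤ m * ℓ := Nat.mul_pos hm hℓ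
  obtain ⟨η, h1, h2, h3⟩ := derivableIn_posX (m := m) hℓ hn (m * ℓ - 1) (by omega)
  rw [Nat.sub_add_cancel hpos] at h2 h3
  have h4 : (∅ : Clause FVar) ∈ η := by
    simpa [posX] using h2 _ (Set.mem_insert _ _)
  obtain ⟨s, r, rfl⟩ := List.append_of_mem h4
  refine ⟨s ++ [∅], ⟨?_, by simp⟩, ?_⟩
  · rw [← List.singleton_append, ← List.append_assoc] at h1
    exact h1.of_append
  · simp at h3 ⊢
    omega

end MergeRes

theorem mainTheorem1 :
    (∃ K : ℝ, ∀ n : ℕ, 2 ≤ n →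
      ((separatingFormula n).vars.card : ℝ) ≤ K * ((n : ℝ) * Real.logb 2 (n : ℝ)) ∧
      ((separatingFormula n).card : ℝ) ≤ K * ((n : ℝ) * Real.logb 2 (n : ℝ)) ∧
      ∃ η : List (Clause FVar), IsResolutionRefutation (separatingFormula n) η ∧
        (η.length : ℝ) ≤ K * ((n : ℝ) * Real.logb 2 (n : ℝ))) ∧
    (∃ c : ℝ, 0 < c ∧ ∀ n : ℕ, 2 ≤ n → ∀ π : RMARefutation (separatingFormula n),
      c * ((n : ℝ) ^ 2 * Real.logb 2 (n : ℝ)) ≤ (π.length : ℝ)) := by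
  -- All three sizes are at most `10nℓ`, and `ℓ = ⌈48x⌉ ≤ 49x`.
  refine ⟨⟨490, fun n hn => ?_⟩, 1 / 8, by norm_num, fun n hn π => le_length_of_refutation hn π⟩
  have h1 := one_le_logb hn
  set x := Real.logb 2 (n : ℝ) with hx
  have ℓ0 : 1 ≤ ⌈48 * x⌉₊ := Nat.one_le_ceil_iff.2 (by linarith)
  have ℓ1 : (⌈48 * x⌉₊ : ℝ) ≤ 49 * x := by
    have := Nat.ceil_lt_add_one (by linarith : 0 ≤ 48 * x)
    linarith
  have bound : ∀ N : ℕ, N ≤ 10 * (n * ⌈48 * x⌉₊) → (N : ℝ) ≤ 490 * (n * x) := fun N hN => by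
    calc (N : ℝ) ≤ 10 * (n * ⌈48 * x⌉₊) := by exact_mod_cast hN
      _ ≤ 10 * (n * (49 * x)) := by gcongr
      _ = _ := by ring
  have hpos : 1 ≤ n * ⌈48 * x⌉₊ := Nat.mul_pos (by omega) ℓ0
  refine ⟨bound _ ?_, bound _ ?_, ?_⟩
  · have := card_vars_formula_le (m := n) ℓ0 (by omega : 1 ≤ n)
    rw [mul_comm _ n] at this
    exact this.trans (by omega)
  · have h2 := card_formula_le ⌈48 * x⌉₊ n n
    have h3 : ⌈48 * x⌉₊ * ((n - 1) * 2) ≤ n * ⌈48 * x⌉₊ * 2 := by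
      rw [mul_comm n, mul_assoc]
      exact Nat.mul_le_mul_left _ (by omega)
    exact h2.trans (by omega)
  · obtain ⟨η, h2, h3⟩ := exists_resolutionRefutation (m := n) ℓ0 (by omega) hn
    refine ⟨η, h2, bound _ (h3.trans ?_)⟩
    rw [mul_assoc]
    omega
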